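/- **Definitions.** A finite semigroup presentation $(S;R)$ consists of a finite set $S$ and a finite set $R$ of pairs $(u,v)$ of nonempty words on $S$, also written as relations $u=v$; $\equiv$ denotes the smallest congruence on the free monoid $S^*$ containing $R$. Fix a linear order on $S$ and let $<$ be the associated deglex order on $S^*$ (compare lengths first, then lexicographically). *Gröbner completion.* A Gröbner basis of $(S;R)$ is a set $B$ of pairs $(u,v)$ with $u\equiv v$ and $u>v$ such that whenever $w\equiv w'$ and $w>w'$, some $(u,v)\in B$ has $u$ as a factor of $w$. It is reduced if for any two distinct elements $(u,v),(u',v')$ of $B$ the word $u'$ is a factor neither of $u$ nor of $v$. The G-completion $\widehat R^{G}$ is the reduced Gröbner basis of $(S;R)$. *Reversing completion.* Let $S^{-1}$ be a disjoint copy of $S$, and for $u=s_1\cdots s_n$ put $u^{-1}=s_n^{-1}\cdots s_1^{-1}$. For a set $R$ of relations, a reversing step on a word over $S\cup S^{-1}$ either deletes a factor $u^{-1}u$ with $u\in S^*$ nonempty, or replaces a factor $u^{-1}v$, with $u,v\in S^*$ nonempty, by $v'u'^{-1}$, where $uv'=vu'$ is a relation of $R$, read in either direction; $w\curvearrowright_R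 w'$ means that $w'$ is obtained from $w$ by finitely many steps. $R$ is R-complete if $u\equiv v$ implies $u^{-1}v\curvearrowright_R\varepsilon$. An obstruction for $R$ is a relation $su=tv$ with $s,t\in S$, $u,v\in S^*$ such that $s^{-1}rr^{-1}t\curvearrowright_R uv^{-1}$ for some $r\in S$ but not $(su)^{-1}(tv)\curvearrowright_R\varepsilon$. The reversing completion starts with $R$ and repeatedly adds an obstruction for the current set of relations; an R-completion $\widehat R^{R}$ of $(S;R)$ is the set of all relations obtained in a finite or infinite run of this procedure, provided that this set has no obstruction. **Proposition.** For each of the following behaviours there are a finite semigroup presentation $(S;R)$ and a linear order on $S$ such that the G-completion exists, an R-completion exists that is R-complete, and the stated behaviour holds for $\widehat R^{G}$ and for every R-completion $\widehat R^{R}$ (that is, whatever the order in which the obstructions are treated): - type 1: $\widehat R^{R}\subsetneq\widehat R^{G}$, with $\widehat R^{R}$ finite and $\widehat R^{G}$ infinite; - type 1': $\widehat R^{R}\subsetneq\widehat R^{G}$, with $\widehat R^{R}$ and $\widehat R^{G}$ both finite; - type 2: $\widehat R^{G}\subsetneq\widehat R^{R}$, with $\widehat R^{G}$ finite and $\widehat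 R^{R}$ infinite; - type 3: neither of $\widehat R^{G}$, $\widehat R^{R}$ is included in the other, even when the relations $u=v$ and $v=u$ are identified. -/

import Mathlib

/-!
Words over an alphabet `α` are lists, relations `u = v` are pairs `(u, v)` of words, and a
presentation is a set of such pairs.
-/

/-- A set of relations between words on `α`. -/
abbrev Relations (α : Type*) := Set (List α × List α)

/-- A finite semigroup presentation: finitely many relations between nonempty words. -/
def IsFinitePresentation {α : Type*} (R : Relations α) : Prop :=
  R.Finite ∧ ∀ p ∈ R, p.1 ≠ [] ∧ p.2 ≠ []

/-- `u ≡ v`: the smallest congruence on the free monoid on `α` that contains `R`. -/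
def WordEquiv {α : Type*} (R : Relations α) (u v : List α) : Prop :=
  conGen (fun x y : FreeMonoid α => (FreeMonoid.toList x, FreeMonoid.toList y) ∈ R)
    (FreeMonoid.ofList u) (FreeMonoid.ofList v)

/-! ### Gröbner completion -/

/-- The deglex order: `u < v` if `u` is shorter than `v`, or if they have the same length and
`u` precedes `v` lexicographically. -/
def Deglex {α : Type*} [LinearOrder α] (u v : List α) : Prop :=
  List.Shortlex (fun a b : α => a < b) u v

/-- `B` is a Gröbner basis of the presentation `R`: all its elements are relations `u = v` that
hold in the presented monoid and satisfy `u > v`, and the larger of any two distinct equivalent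
words has the leading word of an element of `B` as a factor. -/
def IsGroebnerBasis {α : Type*} [LinearOrder α] (R B : Relations α) : Prop :=
  (∀ p ∈ B, WordEquiv R p.1 p.2 ∧ Deglex p.2 p.1) ∧
  ∀ w w' : List α, WordEquiv R w w' → Deglex w' w → ∃ p ∈ B, p.1 <:+: w

/-- No relation of `B` can be reduced, on either side, by another relation of `B`
(the relations of `B` being oriented from left to right). -/
def IsReducedRelations {α : Type*} (B : Relations α) : Prop :=
  ∀ p ∈ B, ∀ q ∈ B, q ≠ p → ¬ q.1 <:+: p.1 ∧ ¬ q.1 <:+: p.2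

/-- The G-completion of `R`, with respect to the deglex order, is its reduced Gröbner basis. -/
def IsGCompletion {α : Type*} [LinearOrder α] (R B : Relations α) : Prop :=
  IsGroebnerBasis R B ∧ IsReducedRelations B

/-! ### Word reversing and the reversing completion -/

/-- Words on `α` together with a disjoint copy of inverses: `(s, true)` is the letter `s` and
`(s, false)` is the letter `s⁻¹`. -/
abbrev SignedWord (α : Type*) := List (α × Bool)

/-- The word `u`, seen as a signed word. -/
def posWord {α : Type*} (u : List α) : SignedWord α := u.map fun s => (s, true)

/-- The signed word `u⁻¹`. -/
def negWord {α : Type*} (u : List α) : SignedWord α := u.reverse.map fun s => (s, false)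

/-- One step of word reversing: delete a factor `u⁻¹ u`, or replace a factor `u⁻¹ v` by
`v' u'⁻¹`, where `u v' = v u'` is a relation (read in either direction); here `u` and `v`
are nonempty. -/
inductive RevStep {α : Type*} (R : Relations α) : SignedWord α → SignedWord α → Prop
  | cancel (x y : SignedWord α) (u : List α) (hu : u ≠ []) :
      RevStep R (x ++ negWord u ++ posWord u ++ y) (x ++ y)
  | relation (x y : SignedWord α) (u v u' v' : List α) (hu : u ≠ []) (hv : v ≠ [])
      (h : (u ++ v', v ++ u') ∈ R ∨ (v ++ u', u ++ v') ∈ R) :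
      RevStep R (x ++ negWord u ++ posWord v ++ y) (x ++ posWord v' ++ negWord u' ++ y)

/-- `w` is reversible to `w'`. -/
def Reverses {α : Type*} (R : Relations α) : SignedWord α → SignedWord α → Prop :=
  Relation.ReflTransGen (RevStep R)

/-- R-completeness: `u ≡ v` implies that `u⁻¹ v` is reversible to the empty word. -/
def IsRComplete {α : Type*} (R : Relations α) : Prop :=
  ∀ u v : List α, WordEquiv R u v → Reverses R (negWord u ++ posWord v) []

/-- For letters `s`, `t`, the relation `s u = t v` is an obstruction for `R` if, for some letter
`r`, the word `s⁻¹ r r⁻¹ t` is reversible to `u v⁻¹`, whereas `(s u)⁻¹ (t v)` is not reversible to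
the empty word. -/
def IsObstruction {α : Type*} (R : Relations α) (s t : α) (u v : List α) : Prop :=
  (∃ r : α, Reverses R (negWord [s] ++ posWord [r] ++ negWord [r] ++ posWord [t])
    (posWord u ++ negWord v)) ∧
  ¬ Reverses R (negWord (s :: u) ++ posWord (t :: v)) []

/-- One step of the reversing completion: add the relation `s u = t v` for an obstruction. -/
def RCompletionStep {α : Type*} (R R' : Relations α) : Prop :=
  ∃ (s t : α) (u v : List α), IsObstruction R s t u v ∧ R' = insert (s :: u, t :: v) R

/-- `C` is the result of a run of the reversing completion on `R`: starting from `R`,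
obstructions are added one at a time, `C` is the set of all relations obtained (after finitely
or infinitely many steps), and no obstruction is left for `C`. The order in which the
obstructions are treated is arbitrary. -/
def IsRCompletion {α : Type*} (R C : Relations α) : Prop :=
  (∃ U : ℕ → Relations α, U 0 = R ∧
    (∀ n, U (n + 1) = U n ∨ RCompletionStep (U n) (U (n + 1))) ∧ C = ⋃ n, U n) ∧
  ∀ (s t : α) (u v : List α), ¬ IsObstruction C s t u v

/-! ### Comparing the completions -/

/-- The unoriented equations underlying a set of relations: `u = v` and `v = u` are identified. -/
def equations {α : Type*} (X : Relations α) : Set (Sym2 (List α)) :=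
  (fun p => s(p.1, p.2)) '' X

/-- The completions of the presentation `R` exist, with a reversing completion that is
R-complete, and `P G C` holds for the G-completion `G` and for every possible result `C` of the
reversing completion. -/
def CompletionsSatisfy {α : Type*} [LinearOrder α] (R : Relations α)
    (P : Relations α → Relations α → Prop) : Prop :=
  (∃ G, IsGCompletion R G) ∧ (∃ C, IsRCompletion R C ∧ IsRComplete C) ∧
  ∀ G C, IsGCompletion R G → IsRCompletion R C → P G C

/-! ### The congruence of a presentation -/

section General

variable {α : Type*} {R B C : Relations α} {u v w : List α}

namespace WordEquiv

/-! Reversing is sound: a signed word labels paths in any right action of the letters compatible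
with the relations, and a reversing step keeps the endpoints (`RevStep.signedPath`). In the Cayley
graph of the monoid this shows that every obstruction is a true equivalence. Hence an R-complete set
has no obstruction, and a run that starts from it never moves. As the reduced Gröbner basis is
unique as well, an R-complete presentation needs only one comparison, of itself with its basis
(`CompletionsSatisfy.of_isRComplete`).

Three types use R-complete presentations. For `b b = a b` (type 1) the reduced basis is the infinite
family `b aⁿ b = aⁿ⁺¹ b`; for `b b = a` (type 1') it gains `b a = a b`; for `b b = a`, `d b b = c`
(type 3) it gains `b a = a b`, while `d b b = c` is reduced to `d a = c`.

For type 2, `a q = p a`, `a z = a y` is its own reduced Gröbner basis, but left cancellation of `a`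
fails for each pair `qⁿ z`, `qⁿ y`. Reversing `a⁻¹ p p⁻¹ a` with the `n`-th relation `a qⁿ z = a qⁿ
y` yields the next one. No other relation can replace it: by `mem_of_reverses_transport`, reversing
`(a qⁿ z)⁻¹ (a qⁿ y)` to the empty word must use that very relation. So every R-completion contains
all of them, up to orientation. -/

theorem refl (u : List α) : WordEquiv R u u := Con.refl _ _

theorem symm (h : WordEquiv R u v) : WordEquiv R v u := Con.symm _ h

theorem trans (h : WordEquiv R u v) (h' : WordEquiv R v w) : WordEquiv R u w := Con.trans _ h h'

theorem append {u' v' : List α} (h : WordEquiv R u v) (h' : WordEquiv R u' v') :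
    WordEquiv R (u ++ u') (v ++ v') := Con.mul _ h h'

theorem append_left (x : List α) (h : WordEquiv R u v) : WordEquiv R (x ++ u) (x ++ v) :=
  (refl x).append h

theorem append_right (h : WordEquiv R u v) (x : List α) : WordEquiv R (u ++ x) (v ++ x) :=
  h.append (refl x)

theorem cons (s : α) (h : WordEquiv R u v) : WordEquiv R (s :: u) (s :: v) := h.append_left [s]

theorem of_mem (h : (u, v) ∈ R) : WordEquiv R u v := ConGen.Rel.of _ _ h

/-- The congruence of a presentation is contained in every congruence containing its relations. -/
theorem elim {r : List α → List α → Prop} (hr : Equivalence r)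
    (happ : ∀ {a b c d}, r a b → r c d → r (a ++ c) (b ++ d)) (hR : ∀ p ∈ R, r p.1 p.2)
    (h : WordEquiv R u v) : r u v := by
  let c : Con (FreeMonoid α) :=
    { r := fun x y => r x.toList y.toList
      iseqv := ⟨fun _ => hr.refl _, fun h => hr.symm h, fun h h' => hr.trans h h'⟩
      mul' := fun h h' => happ h h' }
  have : conGen (fun x y : FreeMonoid α => (x.toList, y.toList) ∈ R) ≤ c :=
    Con.conGen_le.2 fun x y hxy => hR _ hxy
  exact this h

theorem mono (hB : ∀ p ∈ B, WordEquiv R p.1 p.2) (h : WordEquiv B u v) : WordEquiv R u v :=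
  h.elim ⟨refl, symm, trans⟩ append hB

/-- A left action of the letters compatible with the relations is compatible with `≡`. -/
theorem foldr_eq {X : Type*} {f : α → X → X}
    (hR : ∀ p ∈ R, ∀ x, p.1.foldr f x = p.2.foldr f x) (h : WordEquiv R u v) (x : X) :
    u.foldr f x = v.foldr f x :=
  h.elim (r := fun u v => ∀ x, u.foldr f x = v.foldr f x)
    ⟨fun _ _ => rfl, fun h x => (h x).symm, fun h h' x => (h x).trans (h' x)⟩
    (fun h h' x => by simp [List.foldr_append, h, h']) hR x

/-- A right action of the letters compatible with the relations is compatible with `≡`. -/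
theorem foldl_eq {X : Type*} {f : X → α → X}
    (hR : ∀ p ∈ R, ∀ x, p.1.foldl f x = p.2.foldl f x) (h : WordEquiv R u v) (x : X) :
    u.foldl f x = v.foldl f x :=
  h.elim (r := fun u v => ∀ x, u.foldl f x = v.foldl f x)
    ⟨fun _ _ => rfl, fun h x => (h x).symm, fun h h' x => (h x).trans (h' x)⟩
    (fun h h' x => by simp [List.foldl_append, h, h']) hR x

/-- The extension of a substitution is compatible with `≡` if it is with the relations. -/
theorem flatMap_eq {β : Type*} {φ : α → List β} (hR : ∀ p ∈ R, p.1.flatMap φ = p.2.flatMap φ)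
    (h : WordEquiv R u v) : u.flatMap φ = v.flatMap φ :=
  h.elim (r := fun u v => u.flatMap φ = v.flatMap φ) ⟨fun _ => rfl, Eq.symm, Eq.trans⟩
    (fun h h' => by simp [List.flatMap_append, h, h']) hR

end WordEquiv

/-! ### Gröbner bases -/

section Deglex

variable [LinearOrder α]

theorem Deglex.irrefl (u : List α) : ¬ Deglex u u := by
  intro h
  rcases List.shortlex_def.1 h with h | ⟨-, h⟩
  · exact lt_irrefl _ h
  · exact List.lex_irrefl (r := fun a b : α => a < b) (fun a => lt_irrefl a) u h

theorem Deglex.asymm (h : Deglex u v) : ¬ Deglex v u :=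
  Std.Asymm.asymm (r := List.Shortlex fun a b : α => a < b) _ _ h

theorem Deglex.trichotomous (u v : List α) : Deglex u v ∨ u = v ∨ Deglex v u := by
  by_contra! h
  exact h.2.1 (Std.Trichotomous.trichotomous (r := List.Shortlex fun a b : α => a < b)
    u v h.1 h.2.2)

theorem Deglex.length_le (h : Deglex u v) : u.length ≤ v.length := by
  rcases List.shortlex_def.1 h with h | h
  · exact h.le
  · exact h.1.le

theorem Deglex.trans (h : Deglex u v) (h' : Deglex v w) : Deglex u w := by
  rcases List.shortlex_def.1 h with h | ⟨h, hl⟩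
  · exact .of_length_lt (h.trans_le h'.length_le)
  · rcases List.shortlex_def.1 h' with h' | ⟨h', hl'⟩
    · exact .of_length_lt (h ▸ h')
    · exact .of_lex (h.trans h') (List.lex_trans (fun h h' => lt_trans h h') hl hl')

theorem Deglex.not_isInfix (h : Deglex u v) : ¬ v <:+: u := fun hi =>
  Deglex.irrefl u (hi.eq_of_length_le h.length_le ▸ h)

theorem Deglex.append_append (h : Deglex u v) (x y : List α) :
    Deglex (x ++ u ++ y) (x ++ v ++ y) := by
  rw [List.append_assoc, List.append_assoc]
  refine List.Shortlex.append_left ?_ x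
  rcases List.shortlex_def.1 h with h | ⟨h, hl⟩
  · exact .of_length_lt (by simpa using h)
  · refine .of_lex (by simpa using h) ?_
    clear x
    induction hl with
    | nil => simp at h
    | cons hl ih =>
      have hle := Nat.succ.inj h
      exact .cons (ih (.of_lex hle hl) hle)
    | rel hr => exact .rel hr

/-- `w` contains no leading word of `B`. -/
def IsIrreducibleWord (B : Relations α) (w : List α) : Prop := ∀ p ∈ B, ¬ p.1 <:+: w

/-- Every word is equivalent to an irreducible word that is not larger. -/
theorem exists_irreducible [WellFoundedLT α]
    (hB : ∀ p ∈ B, WordEquiv R p.1 p.2 ∧ Deglex p.2 p.1) (w : List α) :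
    ∃ w', WordEquiv R w w' ∧ (w' = w ∨ Deglex w' w) ∧ IsIrreducibleWord B w' := by
  have hwf : WellFounded (Deglex (α := α)) := List.Shortlex.wf wellFounded_lt
  induction w using hwf.induction with
  | _ w ih =>
    by_cases hw : IsIrreducibleWord B w
    · exact ⟨w, .refl w, .inl rfl, hw⟩
    · unfold IsIrreducibleWord at hw
      push Not at hw
      obtain ⟨p, hp, x, y, rfl⟩ := hw
      have hlt := (hB p hp).2.append_append x y
      obtain ⟨w', h1, h2, h3⟩ := ih _ hlt
      refine ⟨w', .trans (((hB p hp).1.append_left x).append_right y) h1, .inr ?_, h3⟩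
      rcases h2 with rfl | h2
      · exact hlt
      · exact h2.trans hlt

/-- A set of oriented consequences of the relations is a Gröbner basis if equivalent irreducible
words are equal. -/
theorem isGroebnerBasis_of_irreducible [WellFoundedLT α]
    (hB : ∀ p ∈ B, WordEquiv R p.1 p.2 ∧ Deglex p.2 p.1)
    (h : ∀ w w', IsIrreducibleWord B w → IsIrreducibleWord B w' → WordEquiv R w w' → w = w') :
    IsGroebnerBasis R B := by
  refine ⟨hB, fun w w' hww' hlt => ?_⟩
  by_contra! hw
  -- An irreducible `w` equals the reduced form of `w'`, which is at most `w'`, against `w' < w`.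
  obtain ⟨w'', h1, h2, h3⟩ := exists_irreducible hB w'
  obtain rfl := h w w'' hw h3 (hww'.trans h1)
  rcases h2 with rfl | h2
  · exact Deglex.irrefl _ hlt
  · exact hlt.asymm h2

/-- The leading word of `p` contains one from `G'`, which in turn contains one from `G`; reducedness
closes this circle, so the leading words agree. The right-hand sides agree because each is the least
word of its class. -/
theorem IsGCompletion.subset {G G' : Relations α} (h : IsGCompletion R G)
    (h' : IsGCompletion R G') : G ⊆ G' := by
  rintro p hp
  obtain ⟨hp1, hp2⟩ := h.1.1 p hp
  obtain ⟨q, hq, hqp⟩ := h'.1.2 _ _ hp1 hp2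
  obtain ⟨hq1, hq2⟩ := h'.1.1 q hq
  obtain ⟨p', hp', hpq⟩ := h.1.2 _ _ hq1 hq2
  have hpp : p' = p := by
    by_contra hne
    exact (h.2 p hp p' hp' hne).1 (hpq.trans hqp)
  subst hpp
  have h1 : p'.1 = q.1 := hpq.eq_of_length_le hqp.length_le
  -- A smaller equivalent word would force a leading word inside `p.2`: that of `p` is too large,
  -- any other is excluded by reducedness.
  have key : ∀ {G : Relations α} {p : List α × List α} {x : List α}, IsGCompletion R G → p ∈ G →
      WordEquiv R p.2 x → ¬ Deglex x p.2 := by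
    intro G p x hG hp hx hlt
    obtain ⟨r, hr, hrp⟩ := hG.1.2 _ _ hx hlt
    by_cases hne : r = p
    · subst hne
      exact (hG.1.1 r hr).2.not_isInfix hrp
    · exact (hG.2 p hp r hr hne).2 hrp
  have h2 : WordEquiv R p'.2 q.2 := hp1.symm.trans (h1 ▸ hq1)
  rcases Deglex.trichotomous p'.2 q.2 with hlt | heq | hlt
  · exact (key h' hq h2.symm hlt).elim
  · rwa [Prod.ext h1 heq]
  · exact (key h hp h2 hlt).elim

/-- The reduced Gröbner basis is unique. -/
theorem IsGCompletion.unique {G G' : Relations α} (h : IsGCompletion R G)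
    (h' : IsGCompletion R G') : G = G' :=
  (h.subset h').antisymm (h'.subset h)

end Deglex

/-! ### Paths and soundness of reversing -/

/-- In a right action of the letters, `SignedPath act w x y` says that `w` labels a path from `x`
to `y`. -/
def SignedPath {X : Type*} (act : X → α → X) : SignedWord α → X → X → Prop
  | [], x, y => x = y
  | (s, true) :: w, x, y => SignedPath act w (act x s) y
  | (s, false) :: w, x, y => ∃ z, act z s = x ∧ SignedPath act w z y

section Path

variable {X : Type*} {act : X → α → X}

theorem signedPath_append (w w' : SignedWord α) (x y : X) :
    SignedPath act (w ++ w') x y ↔ ∃ z, SignedPath act w x z ∧ SignedPath act w' z y := by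
  induction w generalizing x with
  | nil => simp [SignedPath]
  | cons l w ih =>
    obtain ⟨s, _ | _⟩ := l
    · simp only [List.cons_append, SignedPath, ih]
      constructor
      · rintro ⟨z, hz, z', h1, h2⟩
        exact ⟨z', ⟨z, hz, h1⟩, h2⟩
      · rintro ⟨z', ⟨z, hz, h1⟩, h2⟩
        exact ⟨z, hz, z', h1, h2⟩
    · simp only [List.cons_append, SignedPath, ih]

theorem signedPath_posWord (u : List α) (x y : X) :
    SignedPath act (posWord u) x y ↔ u.foldl act x = y := by
  induction u generalizing x with
  | nil => simp [posWord, SignedPath]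
  | cons s u ih => simpa [posWord, SignedPath] using ih (act x s)

theorem negWord_cons (s : α) (u : List α) : negWord (s :: u) = negWord u ++ negWord [s] := by
  simp [negWord]

theorem signedPath_negWord (u : List α) (x y : X) :
    SignedPath act (negWord u) x y ↔ u.foldl act y = x := by
  induction u generalizing y with
  | nil => simp [negWord, SignedPath, eq_comm]
  | cons s u ih =>
    rw [negWord_cons, signedPath_append]
    simp only [ih]
    simp [negWord, SignedPath, eq_comm]

/-- Reversing preserves the paths of a right action compatible with the relations. -/
theorem RevStep.signedPath (hC : ∀ p ∈ C, ∀ x, p.1.foldl act x = p.2.foldl act x)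
    {w w' : SignedWord α} (h : RevStep C w w') {x y : X} (hw : SignedPath act w x y) :
    SignedPath act w' x y := by
  cases h with
  | cancel a b u hu =>
    simp only [signedPath_append, signedPath_posWord, signedPath_negWord] at hw ⊢
    obtain ⟨z, ⟨z', ⟨z'', h1, h2⟩, h3⟩, h4⟩ := hw
    exact ⟨z'', h1, by rwa [← h2, h3]⟩
  | relation a b u v u' v' hu hv hr =>
    simp only [signedPath_append, signedPath_posWord, signedPath_negWord] at hw ⊢
    obtain ⟨z, ⟨z', ⟨z'', h1, h2⟩, h3⟩, h4⟩ := hw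
    -- Reading `u v'` or `v u'` from `z'` leads to the same vertex, through which the new path goes.
    refine ⟨z, ⟨v'.foldl act z'', ⟨z'', h1, rfl⟩, ?_⟩, h4⟩
    rw [← h2, ← h3, ← List.foldl_append, ← List.foldl_append]
    rcases hr with hr | hr
    · exact (hC _ hr z').symm
    · exact hC _ hr z'

theorem Reverses.signedPath (hC : ∀ p ∈ C, ∀ x, p.1.foldl act x = p.2.foldl act x)
    {w w' : SignedWord α} (h : Reverses C w w') {x y : X} (hw : SignedPath act w x y) :
    SignedPath act w' x y := by
  induction h with
  | refl => exact hw
  | tail _ hs ih => exact hs.signedPath hC ih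

end Path

/-- The presented monoid. -/
abbrev QuotientMonoid (R : Relations α) : Type _ :=
  (conGen fun x y : FreeMonoid α => (FreeMonoid.toList x, FreeMonoid.toList y) ∈ R).Quotient

/-- The class of a word in the presented monoid. -/
def wordClass (R : Relations α) (u : List α) : QuotientMonoid R := (FreeMonoid.ofList u : _)

/-- Right multiplication by a letter in the presented monoid. -/
def mulLetter (R : Relations α) (x : QuotientMonoid R) (s : α) : QuotientMonoid R :=
  x * wordClass R [s]

theorem wordClass_eq_iff : wordClass R u = wordClass R v ↔ WordEquiv R u v := Con.eq _

theorem foldl_mulLetter (u v : List α) :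
    v.foldl (mulLetter R) (wordClass R u) = wordClass R (u ++ v) := by
  induction v generalizing u with
  | nil => simp
  | cons s v ih =>
    have : mulLetter R (wordClass R u) s = wordClass R (u ++ [s]) := rfl
    rw [List.foldl_cons, this, ih]
    simp

theorem mulLetter_compatible (hC : ∀ p ∈ C, WordEquiv R p.1 p.2) :
    ∀ p ∈ C, ∀ x, p.1.foldl (mulLetter R) x = p.2.foldl (mulLetter R) x := by
  intro p hp x
  obtain ⟨u, rfl⟩ : ∃ u, x = wordClass R u := by
    induction x using Con.induction_on with
    | H x => exact ⟨x.toList, rfl⟩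
  rw [foldl_mulLetter, foldl_mulLetter, wordClass_eq_iff]
  exact (hC p hp).append_left u

/-- If `s⁻¹ r r⁻¹ t` is reversible to `u v⁻¹`, then `s u ≡ t v`. -/
theorem wordEquiv_of_reverses (hC : ∀ p ∈ C, WordEquiv R p.1 p.2) {r s t : α}
    (h : Reverses C (negWord [s] ++ posWord [r] ++ negWord [r] ++ posWord [t])
      (posWord u ++ negWord v)) : WordEquiv R (s :: u) (t :: v) := by
  have key : SignedPath (mulLetter R) (negWord [s] ++ posWord [r] ++ negWord [r] ++ posWord [t])
      (wordClass R [s]) (wordClass R [t]) := by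
    simp only [signedPath_append, signedPath_posWord, signedPath_negWord]
    -- The path runs from `s` back to `1`, out to `r`, back to `1`, and on to `t`.
    refine ⟨wordClass R [], ⟨wordClass R [r], ⟨wordClass R [], ?_, ?_⟩, ?_⟩, ?_⟩ <;>
      exact foldl_mulLetter _ _
  have := h.signedPath (mulLetter_compatible hC) key
  simp only [signedPath_append, signedPath_posWord, signedPath_negWord] at this
  obtain ⟨z, h1, h2⟩ := this
  rw [foldl_mulLetter] at h1 h2
  exact wordClass_eq_iff.1 (h1.trans h2.symm)

/-! ### Complete sets of relations -/

/-- By soundness the first half of an obstruction gives `s u ≡ t v`, and completeness then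
contradicts the second half. -/
theorem IsRComplete.not_isObstruction (h : IsRComplete R) (s t : α) (u v : List α) :
    ¬ IsObstruction R s t u v := by
  rintro ⟨⟨r, hr⟩, hn⟩
  exact hn (h _ _ (wordEquiv_of_reverses (fun p hp => .of_mem hp) hr))

theorem IsRComplete.isRCompletion (h : IsRComplete R) : IsRCompletion R R :=
  ⟨⟨fun _ => R, rfl, fun _ => .inl rfl, (Set.iUnion_const R).symm⟩, h.not_isObstruction⟩

theorem IsRCompletion.subset (h : IsRCompletion R C) : R ⊆ C := by
  obtain ⟨⟨U, h0, -, rfl⟩, -⟩ := h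
  exact h0 ▸ Set.subset_iUnion U 0

theorem IsRCompletion.eq_of_isRComplete (h : IsRComplete R) (hC : IsRCompletion R C) : C = R := by
  obtain ⟨⟨U, h0, hU, rfl⟩, -⟩ := hC
  have : ∀ n, U n = R := by
    intro n
    induction n with
    | zero => exact h0
    | succ n ih =>
      rcases hU n with h' | ⟨s, t, u, v, ho, -⟩
      · rw [h', ih]
      · exact (h.not_isObstruction s t u v (ih ▸ ho)).elim
  simp only [this, Set.iUnion_const]

/-- Soundness, applied at each stage of the run, makes every added obstruction a consequence of `R`.
-/
theorem IsRCompletion.wordEquiv (h : IsRCompletion R C) : ∀ p ∈ C, WordEquiv R p.1 p.2 := by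
  obtain ⟨⟨U, h0, hU, rfl⟩, -⟩ := h
  have : ∀ n, ∀ p ∈ U n, WordEquiv R p.1 p.2 := by
    intro n
    induction n with
    | zero => exact fun p hp => .of_mem (h0 ▸ hp)
    | succ n ih =>
      rcases hU n with h' | ⟨s, t, u, v, ⟨⟨r, hr⟩, -⟩, h'⟩
      · rwa [h']
      · rw [h']
        rintro p (rfl | hp)
        · exact wordEquiv_of_reverses ih hr
        · exact ih p hp
  intro p hp
  obtain ⟨n, hn⟩ := Set.mem_iUnion.1 hp
  exact this n p hn

/-- Comparison of the completions of a complete presentation, in terms of its reduced Gröbner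
basis. -/
theorem CompletionsSatisfy.of_isRComplete [LinearOrder α] {G : Relations α}
    {P : Relations α → Relations α → Prop} (hG : IsGCompletion R G) (hR : IsRComplete R)
    (hP : P G R) : CompletionsSatisfy R P := by
  refine ⟨⟨G, hG⟩, ⟨R, hR.isRCompletion, hR⟩, fun G' C hG' hC => ?_⟩
  rwa [hG'.unique hG, hC.eq_of_isRComplete hR]

/-! ### Reversing computations -/

theorem Reverses.append (x y : SignedWord α) {w w' : SignedWord α} (h : Reverses R w w') :
    Reverses R (x ++ w ++ y) (x ++ w' ++ y) := by
  induction h with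
  | refl => exact .refl
  | tail _ h ih =>
    refine ih.tail ?_
    cases h with
    | cancel a b u hu => simpa using RevStep.cancel (R := R) (x ++ a) (b ++ y) u hu
    | relation a b u v u' v' hu hv hr =>
      simpa using RevStep.relation (R := R) (x ++ a) (b ++ y) u v u' v' hu hv hr

theorem negWord_append (u v : List α) : negWord (u ++ v) = negWord v ++ negWord u := by
  simp [negWord]

theorem posWord_append (u v : List α) : posWord (u ++ v) = posWord u ++ posWord v := by
  simp [posWord]

theorem negWord_nil : negWord ([] : List α) = [] := rfl

theorem posWord_nil : posWord ([] : List α) = [] := rfl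

theorem reverses_cancel (u : List α) : Reverses R (negWord u ++ posWord u) [] := by
  by_cases hu : u = []
  · subst hu; exact .refl
  · exact .single (by simpa using RevStep.cancel (R := R) [] [] u hu)

theorem reverses_relation {u v u' v' : List α} (hu : u ≠ []) (hv : v ≠ [])
    (h : (u ++ v', v ++ u') ∈ R ∨ (v ++ u', u ++ v') ∈ R) :
    Reverses R (negWord u ++ posWord v) (posWord v' ++ negWord u') :=
  .single (by simpa using RevStep.relation (R := R) [] [] u v u' v' hu hv h)

theorem reverses_cancel_append (x u v : List α) :
    Reverses R (negWord (x ++ u) ++ posWord (x ++ v)) (negWord u ++ posWord v) := by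
  simpa [negWord_append, posWord_append] using (reverses_cancel x).append (negWord u) (posWord v)

/-- Reversing the middle of `(s u)⁻¹ (t v)`. -/
theorem Reverses.cons_cons {s t : α} {w : SignedWord α} (u v : List α)
    (h : Reverses R (negWord [s] ++ posWord [t]) w) :
    Reverses R (negWord (s :: u) ++ posWord (t :: v)) (negWord u ++ w ++ posWord v) := by
  simpa [negWord, posWord] using h.append (negWord u) (posWord v)

theorem Reverses.trans {w w' w'' : SignedWord α} (h : Reverses R w w') (h' : Reverses R w' w'') :
    Reverses R w w'' := Relation.ReflTransGen.trans h h'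

/-! ### The first reversing step -/

theorem Reverses.eq_of_signedPath {X : Type*} {act : X → α → X}
    (hC : ∀ p ∈ C, ∀ x, p.1.foldl act x = p.2.foldl act x)
    {w : SignedWord α} (h : Reverses C w []) {x y : X} (hw : SignedPath act w x y) : x = y :=
  h.signedPath hC hw

theorem posWord_cons (s : α) (u : List α) : posWord (s :: u) = posWord [s] ++ posWord u := rfl

/-- The word `p⁻¹ q` passes from negative to positive letters only once, so a factor `u⁻¹ v` must
straddle that place. -/
theorem signedWord_append_inj {x y : SignedWord α} {p q : List α} (hu : u ≠ []) (hv : v ≠ [])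
    (h : x ++ negWord u ++ posWord v ++ y = negWord p ++ posWord q) :
    (∃ u', p = u ++ u' ∧ x = negWord u') ∧ ∃ v', q = v ++ v' ∧ y = posWord v' := by
  have hsplit : x ++ negWord u = negWord p ∧ posWord v ++ y = posWord q := by
    rw [List.append_assoc] at h
    obtain ⟨c, h1, h2⟩ | ⟨c, h1, h2⟩ := List.append_eq_append_iff.1 h
    · match c, v with
      | [], _ => exact ⟨by simpa using h1.symm, by simpa using h2⟩
      | l :: c, [] => exact (hv rfl).elim
      | l :: c, s :: v =>
        have hl : l = (s, true) := by simpa [posWord] using congrArg List.head? h2.symm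
        have : l ∈ negWord p := by rw [h1]; simp
        simp [negWord, hl] at this
    · rcases c.eq_nil_or_concat with rfl | ⟨c, l, rfl⟩
      · exact ⟨by simpa using h1, by simpa using h2.symm⟩
      · match u with
        | [] => exact (hu rfl).elim
        | s :: u =>
          have hl : l = (s, false) := by
            simpa [negWord, List.getLast?_append] using (congrArg List.getLast? h1).symm
          have : l ∈ posWord q := by rw [h2]; simp
          simp [posWord, hl] at this
  have inj : ∀ b : Bool, Function.Injective fun s : α => (s, b) := fun b s t h => by simpa using h
  obtain ⟨h1, h2⟩ := hsplit
  constructor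
  · obtain ⟨l₁, l₂, hp, hx, hl⟩ := List.map_eq_append_iff.1 h1.symm
    have := (List.map_injective_iff.2 (inj false)) hl
    subst this
    exact ⟨l₁.reverse, by simpa using congrArg List.reverse hp, by simp [negWord, hx]⟩
  · obtain ⟨l₁, l₂, hq, hl, hy⟩ := List.map_eq_append_iff.1 h2.symm
    have := (List.map_injective_iff.2 (inj true)) hl
    subst this
    exact ⟨l₂, hq, hy.symm⟩

/-- The first step in the reversing of `p⁻¹ q`. -/
theorem Reverses.exists_first_step {p q : List α} (hp : p ≠ [])
    (h : Reverses C (negWord p ++ posWord q) []) :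
    ∃ u v u' v' U V : List α, u ≠ [] ∧ v ≠ [] ∧ p = u ++ U ∧ q = v ++ V ∧
      (u = v ∧ u' = [] ∧ v' = [] ∨ (u ++ v', v ++ u') ∈ C ∨ (v ++ u', u ++ v') ∈ C) ∧
      Reverses C (negWord U ++ posWord v' ++ negWord u' ++ posWord V) [] := by
  rcases Relation.ReflTransGen.cases_head h with h | ⟨w, h, h'⟩
  · simp [negWord, hp] at h
  · generalize hw : negWord p ++ posWord q = w₀ at h
    cases h with
    | cancel x y u hu =>
      obtain ⟨⟨U, rfl, rfl⟩, V, rfl, rfl⟩ := signedWord_append_inj hu hu hw.symm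
      exact ⟨u, u, [], [], U, V, hu, hu, rfl, rfl, .inl ⟨rfl, rfl, rfl⟩,
        by simpa [Reverses, posWord_nil, negWord_nil] using h'⟩
    | relation x y u v u' v' hu hv hr =>
      obtain ⟨⟨U, rfl, rfl⟩, V, rfl, rfl⟩ := signedWord_append_inj hu hv hw.symm
      exact ⟨u, v, u', v', U, V, hu, hv, rfl, rfl, .inr hr, h'⟩

end General

/-! ### Substitution presentations -/

section Substitution

variable {α β : Type*} {R : Relations α}

/-- Suppose that a nonerasing substitution `φ` is compatible with the relations, and that
`φ (s u) = φ (t v)` with `s ≠ t` is possible only if there is a relation `s = t x` or `t = s x`.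
Then `R` is complete. -/
theorem isRComplete_of_substitution (φ : α → List β) (hφ : ∀ s, φ s ≠ [])
    (hR : ∀ p ∈ R, p.1.flatMap φ = p.2.flatMap φ)
    (h : ∀ s t u v, s ≠ t → (s :: u).flatMap φ = (t :: v).flatMap φ →
      ∃ x, (t :: x, [s]) ∈ R ∨ (s :: x, [t]) ∈ R) : IsRComplete R := by
  have hpos : ∀ s, 0 < (φ s).length := fun s => List.length_pos_iff.2 (hφ s)
  have key : ∀ n, ∀ u v : List α, (u.flatMap φ).length = n → u.flatMap φ = v.flatMap φ →
      -- Induction on the length of the image of `u`: the word `u` itself may grow when a letter is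
      -- replaced by the other side of a relation.
      Reverses R (negWord u ++ posWord v) [] := by
    intro n
    induction n using Nat.strong_induction_on with
    | _ n ih =>
      intro u v hn huv
      match u, v with
      | [], [] => exact .refl
      | [], t :: v => simp_all [eq_comm]
      | s :: u, [] => simp_all
      | s :: u, t :: v =>
        by_cases hst : s = t
        · subst hst
          refine (reverses_cancel_append [s] u v).trans (ih _ ?_ u v rfl (by simpa using huv))
          have := hpos s
          simp only [List.flatMap_cons, List.length_append] at hn
          omega
        · obtain ⟨x, hx | hx⟩ := h s t u v hst huv
          · have hs := hR _ hx
            simp only [List.flatMap_cons, List.flatMap_nil, List.append_nil] at hs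
            simp only [List.flatMap_cons, ← hs, List.append_assoc, List.append_cancel_left_eq]
              at huv
            refine (Reverses.cons_cons u v (w := negWord x)
              -- With `t x = s`, the factor `s⁻¹ t` becomes `x⁻¹`, leaving `(x u)⁻¹ v`; the image
              -- has lost the nonempty word `φ t`.
              (reverses_relation (u := [s]) (v := [t]) (u' := x) (v' := [])
                (by simp) (by simp) (.inr hx))).trans ?_
            rw [← negWord_append]
            refine ih _ ?_ (x ++ u) v rfl (by simpa using huv)
            have := hpos t
            have hl := congrArg List.length hs
            simp only [List.flatMap_cons, List.length_append, List.flatMap_append] at hn hl ⊢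
            omega
          · have hs := hR _ hx
            simp only [List.flatMap_cons, List.flatMap_nil, List.append_nil] at hs
            simp only [List.flatMap_cons, ← hs, List.append_assoc, List.append_cancel_left_eq]
              at huv
            refine (Reverses.cons_cons u v (w := posWord x)
              (by simpa [negWord_nil] using
              (reverses_relation (u := [s]) (v := [t]) (u' := []) (v' := x)
                (by simp) (by simp) (.inl hx)))).trans ?_
            rw [List.append_assoc, ← posWord_append]
            refine ih _ ?_ u (x ++ v) rfl (by simpa using huv)
            have := hpos s
            simp only [List.flatMap_cons, List.length_append] at hn
            omega
  exact fun u v huv => key _ u v rfl (huv.flatMap_eq hR)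

end Substitution

/-! ### The monoid `⟨a, b | b b = a⟩` -/

section Square

/-- The presentation `b b = a`, with `a = 0` and `b = 1`. -/
def squareRelations : Relations (Fin 2) := {([1, 1], [0])}

/-- The reduced Gröbner basis of `squareRelations`. -/
def squareBasis : Relations (Fin 2) := {([1, 1], [0]), ([1, 0], [0, 1])}

/-- The substitution `a ↦ b b`. -/
def squareSubst (s : Fin 2) : List (Fin 2) := if s = 0 then [1, 1] else [s]

theorem squareSubst_compatible :
    ∀ p ∈ squareRelations, p.1.flatMap squareSubst = p.2.flatMap squareSubst := by
  rintro p rfl; decide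

theorem isRComplete_square : IsRComplete squareRelations := by
  refine isRComplete_of_substitution squareSubst (by decide) squareSubst_compatible ?_
  intro s t u v hst _
  refine ⟨[1], ?_⟩
  revert hst
  fin_cases s <;> fin_cases t <;> simp [squareRelations]

/-- Both words are equivalent to `b b b`. -/
theorem wordEquiv_square_comm : WordEquiv squareRelations [1, 0] [0, 1] := by
  have h : WordEquiv squareRelations [1, 1] [0] := .of_mem rfl
  exact (h.symm.append_left [1]).trans (h.append_right [1])

/-- In an irreducible word `b` can only be the last letter, so the word is `aⁱ` or `aⁱ b`, with
image `b²ⁱ` or `b²ⁱ⁺¹`. -/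
theorem eq_of_irreducible_square (w w' : List (Fin 2)) (hw : IsIrreducibleWord squareBasis w)
    (hw' : IsIrreducibleWord squareBasis w')
    (h : w.flatMap squareSubst = w'.flatMap squareSubst) : w = w' := by
  have tail : ∀ {s : Fin 2} {w}, IsIrreducibleWord squareBasis (s :: w) →
      IsIrreducibleWord squareBasis w :=
    fun h p hp hi => h p hp (hi.trans (List.suffix_cons _ _).isInfix)
  have one : ∀ {w}, IsIrreducibleWord squareBasis (1 :: w) → w = [] := by
    intro w h
    match w with
    | [] => rfl
    | s :: w =>
      fin_cases s
      · exact (h ([1, 0], [0, 1]) (by simp [squareBasis]) ⟨[], w, rfl⟩).elim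
      · exact (h ([1, 1], [0]) (by simp [squareBasis]) ⟨[], w, rfl⟩).elim
  induction w generalizing w' with
  | nil =>
    match w' with
    | [] => rfl
    | s :: w' => fin_cases s <;> simp [squareSubst] at h
  | cons s w ih =>
    match w' with
    | [] => fin_cases s <;> simp [squareSubst] at h
    | t :: w' =>
      fin_cases s <;> fin_cases t
      · exact congrArg _ (ih w' (tail hw) (tail hw') (by simpa [squareSubst] using h))
      · obtain rfl := one hw'; simp [squareSubst] at h
      · obtain rfl := one hw; simp [squareSubst] at h
      · obtain rfl := one hw; obtain rfl := one hw'; rfl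

theorem isGCompletion_square : IsGCompletion squareRelations squareBasis := by
  refine ⟨isGroebnerBasis_of_irreducible ?_ fun w w' hw hw' h =>
    eq_of_irreducible_square w w' hw hw' (h.flatMap_eq squareSubst_compatible), ?_⟩
  · rintro p (rfl | rfl)
    · exact ⟨.of_mem rfl, .of_length_lt (by simp)⟩
    · exact ⟨wordEquiv_square_comm, .of_lex rfl (.rel (by decide))⟩
  · unfold IsReducedRelations squareBasis
    simp only [Set.mem_insert_iff, Set.mem_singleton_iff, forall_eq_or_imp, forall_eq]
    decide

theorem completions_square : CompletionsSatisfy squareRelations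
    fun G C => C ⊂ G ∧ C.Finite ∧ G.Finite := by
  refine .of_isRComplete isGCompletion_square isRComplete_square ⟨?_, ?_, ?_⟩
  · refine ⟨by simp [squareRelations, squareBasis], fun h => ?_⟩
    have : (([1, 0], [0, 1]) : List (Fin 2) × List (Fin 2)) ∈ squareRelations :=
      h (by simp [squareBasis])
    simp [squareRelations] at this
  · exact Set.finite_singleton _
  · exact (Set.finite_singleton _).insert _

end Square

/-! ### The monoid `⟨a, b, c, d | b b = a, d b b = c⟩` -/

section DoubleSquare

/-- The presentation `b b = a`, `d b b = c`, with `a = 0`, `b = 1`, `c = 2`, `d = 3`. -/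
def doubleSquareRelations : Relations (Fin 4) := {([1, 1], [0]), ([3, 1, 1], [2])}

/-- The reduced Gröbner basis of `doubleSquareRelations`. -/
def doubleSquareBasis : Relations (Fin 4) :=
  {([1, 1], [0]), ([1, 0], [0, 1]), ([3, 0], [2])}

/-- The substitution `a ↦ b b`, `c ↦ d b b`. -/
def doubleSquareSubst : Fin 4 → List (Fin 4) := ![[1, 1], [1], [3, 1, 1], [3]]

theorem doubleSquareSubst_compatible : ∀ p ∈ doubleSquareRelations,
    p.1.flatMap doubleSquareSubst = p.2.flatMap doubleSquareSubst := by
  rintro p (rfl | rfl) <;> decide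

/-- Images of distinct letters share their first letter only for the pairs `a`, `b` and `c`, `d`,
which the two relations link. -/
theorem isRComplete_doubleSquare : IsRComplete doubleSquareRelations := by
  refine isRComplete_of_substitution doubleSquareSubst (by decide) doubleSquareSubst_compatible ?_
  intro s t u v hst h
  fin_cases s <;> fin_cases t <;>
    first
    | exact absurd rfl hst
    | (refine ⟨[1], ?_⟩; simp [doubleSquareRelations]; done)
    | (refine ⟨[1, 1], ?_⟩; simp [doubleSquareRelations]; done)
    | simp [doubleSquareSubst] at h

theorem wordEquiv_doubleSquare : WordEquiv doubleSquareRelations [1, 1] [0] :=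
  .of_mem (by simp [doubleSquareRelations])

/-- The first letter can be read off the image: after an irreducible initial `b` the image does not
go on with `b`, and after an initial `d` it does not go on with `b b`. -/
theorem eq_of_irreducible_doubleSquare (w w' : List (Fin 4))
    (hw : IsIrreducibleWord doubleSquareBasis w) (hw' : IsIrreducibleWord doubleSquareBasis w')
    (h : w.flatMap doubleSquareSubst = w'.flatMap doubleSquareSubst) : w = w' := by
  have tail : ∀ {s : Fin 4} {w}, IsIrreducibleWord doubleSquareBasis (s :: w) →
      IsIrreducibleWord doubleSquareBasis w :=
    fun h p hp hi => h p hp (hi.trans (List.suffix_cons _ _).isInfix)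
  have one : ∀ {w v}, IsIrreducibleWord doubleSquareBasis (1 :: w) →
      w.flatMap doubleSquareSubst ≠ 1 :: v := by
    intro w v h
    match w with
    | [] => simp
    | s :: w =>
      fin_cases s
      · exact (h ([1, 0], [0, 1]) (by simp [doubleSquareBasis]) ⟨[], w, rfl⟩).elim
      · exact (h ([1, 1], [0]) (by simp [doubleSquareBasis]) ⟨[], w, rfl⟩).elim
      · simp [doubleSquareSubst]
      · simp [doubleSquareSubst]
  have three : ∀ {w v}, IsIrreducibleWord doubleSquareBasis (3 :: w) →
      w.flatMap doubleSquareSubst ≠ 1 :: 1 :: v := by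
    intro w v h
    match w with
    | [] => simp
    | s :: w =>
      fin_cases s
      · exact (h ([3, 0], [2]) (by simp [doubleSquareBasis]) ⟨[], w, rfl⟩).elim
      · have := one (tail h) (v := v)
        simpa [doubleSquareSubst] using this
      · simp [doubleSquareSubst]
      · simp [doubleSquareSubst]
  induction w generalizing w' with
  | nil =>
    match w' with
    | [] => rfl
    | s :: w' => fin_cases s <;> simp [doubleSquareSubst] at h
  | cons s w ih =>
    match w' with
    | [] => fin_cases s <;> simp [doubleSquareSubst] at h
    | t :: w' =>
      by_cases hst : s = t
      · subst hst
        exact congrArg _ (ih w' (tail hw) (tail hw') (by simpa using h))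
      · fin_cases s <;> fin_cases t <;> simp [doubleSquareSubst] at h hst
        · exact (one hw' h.symm).elim
        · exact (one hw h).elim
        · exact (three hw' h.symm).elim
        · exact (three hw h).elim

theorem isGCompletion_doubleSquare : IsGCompletion doubleSquareRelations doubleSquareBasis := by
  refine ⟨isGroebnerBasis_of_irreducible ?_ fun w w' hw hw' h =>
    eq_of_irreducible_doubleSquare w w' hw hw' (h.flatMap_eq doubleSquareSubst_compatible), ?_⟩
  · have h := wordEquiv_doubleSquare
    rintro p (rfl | rfl | rfl)
    · exact ⟨h, .of_length_lt (by simp)⟩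
    · exact ⟨(h.symm.append_left [1]).trans (h.append_right [1]), .of_lex rfl (.rel (by decide))⟩
    · exact ⟨(h.symm.append_left [3]).trans (.of_mem (by simp [doubleSquareRelations])),
        .of_length_lt (by simp)⟩
  · unfold IsReducedRelations doubleSquareBasis
    simp only [Set.mem_insert_iff, Set.mem_singleton_iff, forall_eq_or_imp, forall_eq]
    refine ⟨⟨?_, ?_, ?_⟩, ⟨?_, ?_, ?_⟩, ?_, ?_, ?_⟩ <;> decide

theorem completions_doubleSquare : CompletionsSatisfy doubleSquareRelations
    fun G C => ¬ equations G ⊆ equations C ∧ ¬ equations C ⊆ equations G := by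
  refine .of_isRComplete isGCompletion_doubleSquare isRComplete_doubleSquare ⟨?_, ?_⟩
  · intro h
    have := h ⟨([1, 0], [0, 1]), by simp [doubleSquareBasis], rfl⟩
    simp [equations, doubleSquareRelations] at this
  · intro h
    have := h ⟨([3, 1, 1], [2]), by simp [doubleSquareRelations], rfl⟩
    simp [equations, doubleSquareBasis] at this

end DoubleSquare

/-! ### The monoid `⟨a, b | b b = a b⟩` -/

section Absorbing

/-- The presentation `b b = a b`, with `a = 0` and `b = 1`. -/
def absorbingRelations : Relations (Fin 2) := {([1, 1], [0, 1])}

/-- The reduced Gröbner basis of `absorbingRelations`: the relations `b aⁿ b = aⁿ⁺¹ b`. -/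
def absorbingBasis : Relations (Fin 2) :=
  Set.range fun n : ℕ => (1 :: (List.replicate n 0 ++ [1]), 0 :: (List.replicate n 0 ++ [1]))

/-- Left multiplication by a letter on normal forms: every `b` but the last one becomes `a`. -/
def absorb (s : Fin 2) (n : List (Fin 2)) : List (Fin 2) := if 1 ∈ n then 0 :: n else s :: n

/-- The normal form of a word. -/
def absorbNF (u : List (Fin 2)) : List (Fin 2) := u.foldr absorb []

theorem absorbNF_cons (s : Fin 2) (u : List (Fin 2)) :
    absorbNF (s :: u) = absorb s (absorbNF u) := rfl

theorem mem_absorbNF {u : List (Fin 2)} : 1 ∈ absorbNF u ↔ 1 ∈ u := by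
  induction u with
  | nil => simp [absorbNF]
  | cons s u ih =>
    rw [absorbNF_cons, absorb]
    split_ifs with h
    · simp [h, ih.1 h]
    · simp [ih]

theorem absorbNF_cons_of_mem (s : Fin 2) {u : List (Fin 2)} (h : 1 ∈ u) :
    absorbNF (s :: u) = 0 :: absorbNF u := by
  rw [absorbNF_cons, absorb, if_pos (mem_absorbNF.2 h)]

theorem absorbNF_cons_of_notMem (s : Fin 2) {u : List (Fin 2)} (h : 1 ∉ u) :
    absorbNF (s :: u) = s :: absorbNF u := by
  rw [absorbNF_cons, absorb, if_neg (mem_absorbNF.not.2 h)]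

theorem absorbNF_zero_cons (u : List (Fin 2)) : absorbNF (0 :: u) = 0 :: absorbNF u := by
  by_cases h : 1 ∈ u
  · exact absorbNF_cons_of_mem 0 h
  · exact absorbNF_cons_of_notMem 0 h

theorem absorbNF_eq {u v : List (Fin 2)} (h : WordEquiv absorbingRelations u v) :
    absorbNF u = absorbNF v := by
  refine h.foldr_eq ?_ []
  rintro p rfl x
  by_cases hx : 1 ∈ x <;> simp [absorb, hx]

/-- A word that contains `b` can be written `aⁱ b u`. -/
theorem exists_eq_replicate_append {u : List (Fin 2)} (h : 1 ∈ u) :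
    ∃ i v, u = List.replicate i 0 ++ 1 :: v := by
  induction u with
  | nil => simp at h
  | cons s u ih =>
    fin_cases s
    · obtain ⟨i, v, rfl⟩ := ih (by simpa using h)
      exact ⟨i + 1, v, rfl⟩
    · exact ⟨0, u, rfl⟩

theorem absorbNF_replicate_append (i : ℕ) (s t : Fin 2) (u : List (Fin 2)) (h : 1 ∈ u) :
    absorbNF (List.replicate i s ++ u) = absorbNF (List.replicate i t ++ u) := by
  induction i with
  | zero => rfl
  | succ i ih =>
    rw [List.replicate_succ, List.replicate_succ, List.cons_append, List.cons_append,
      absorbNF_cons_of_mem _ (by simp [h]), absorbNF_cons_of_mem _ (by simp [h]), ih]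

/-- The head of the normal form of `b u` tells whether `u` contains `b`; its tail is the normal form
of `u` in both cases. So `b` is left cancellable. -/
theorem absorbNF_one_cons_injective {u v : List (Fin 2)}
    (h : absorbNF (1 :: u) = absorbNF (1 :: v)) : absorbNF u = absorbNF v := by
  by_cases hu : 1 ∈ u <;> by_cases hv : 1 ∈ v
  · simpa [absorbNF_cons_of_mem, hu, hv] using h
  · simp [absorbNF_cons_of_mem, absorbNF_cons_of_notMem, hu, hv] at h
  · simp [absorbNF_cons_of_mem, absorbNF_cons_of_notMem, hu, hv] at h
  · simpa [absorbNF_cons_of_notMem, hu, hv] using h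

/-- The letter `b⁻¹` moves right through the `a`'s, since `b⁻¹ a` reverses to `b b⁻¹`, and finally
cancels with `b`. -/
theorem reverses_b_replicate (i : ℕ) :
    Reverses absorbingRelations (negWord [1] ++ posWord (List.replicate i 0 ++ [1]))
      (posWord (List.replicate i 1)) := by
  induction i with
  | zero => exact reverses_cancel [1]
  | succ i ih =>
    have h : Reverses absorbingRelations (negWord [1] ++ posWord [0]) (posWord [1] ++ negWord [1]) :=
      reverses_relation (by simp) (by simp) (.inl rfl)
    refine (h.cons_cons [] _).trans ?_
    simpa [List.replicate_succ, posWord, negWord] using ih.append (posWord [1]) []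

theorem reverses_replicate_b (i : ℕ) :
    Reverses absorbingRelations (negWord (List.replicate i 0 ++ [1]) ++ posWord [1])
      (negWord (List.replicate i 1)) := by
  induction i with
  | zero => exact reverses_cancel [1]
  | succ i ih =>
    have h : Reverses absorbingRelations (negWord [0] ++ posWord [1]) (posWord [1] ++ negWord [1]) :=
      reverses_relation (by simp) (by simp) (.inr rfl)
    refine (h.cons_cons _ []).trans ?_
    rw [List.replicate_succ, negWord_cons]
    simpa [posWord, negWord] using ih.append [] (negWord [1])

/-- Induction on length. Equal first letters cancel. Otherwise a step produces `u⁻¹ b b⁻¹ v`, where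
both `u = aⁱ b u'` and `v = aʲ b v'` contain `b`; absorbing the two middle letters leaves `(bⁱ u')⁻¹
(bʲ v')`, which is shorter. -/
theorem reverses_of_absorbNF_eq : ∀ n, ∀ u v : List (Fin 2), u.length = n →
    absorbNF u = absorbNF v → Reverses absorbingRelations (negWord u ++ posWord v) [] := by
  have hlen : ∀ u, (absorbNF u).length = u.length := by
    intro u
    induction u with
    | nil => rfl
    | cons s u ih =>
      rw [absorbNF_cons, absorb]
      split_ifs <;> simp [ih]
  intro n
  induction n using Nat.strong_induction_on with
  | _ n ih =>
    intro u v hn h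
    have mem : ∀ {u v : List (Fin 2)}, absorbNF (0 :: u) = absorbNF (1 :: v) →
        1 ∈ u ∧ absorbNF u = absorbNF v := by
      intro u v h
      have hv : 1 ∈ v := by
        by_contra hv
        simp [absorbNF_zero_cons, absorbNF_cons_of_notMem, hv] at h
      rw [absorbNF_zero_cons, absorbNF_cons_of_mem _ hv, List.cons_inj_right] at h
      exact ⟨by rwa [← mem_absorbNF, h, mem_absorbNF], h⟩
    have key : ∀ u v : List (Fin 2), u.length + 1 = n → 1 ∈ u → absorbNF u = absorbNF v →
        Reverses absorbingRelations
          (negWord u ++ (posWord [1] ++ negWord [1]) ++ posWord v) [] := by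
      intro u v hn hu h
      have hv : 1 ∈ v := by rwa [← mem_absorbNF, ← h, mem_absorbNF]
      obtain ⟨i, u', rfl⟩ := exists_eq_replicate_append hu
      obtain ⟨j, v', rfl⟩ := exists_eq_replicate_append hv
      have h1 : Reverses absorbingRelations
          (negWord (List.replicate i 0 ++ 1 :: u') ++ posWord [1])
          (negWord (List.replicate i 1 ++ u')) := by
        have := (reverses_replicate_b i).append (negWord u') []
        simpa [negWord_append, negWord_cons 1 u'] using this
      have h2 : Reverses absorbingRelations
          (negWord [1] ++ posWord (List.replicate j 0 ++ 1 :: v'))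
          (posWord (List.replicate j 1 ++ v')) := by
        have := (reverses_b_replicate j).append [] (posWord v')
        simpa [posWord] using this
      refine .trans (by simpa using h1.append [] (negWord [1] ++ posWord _)) ?_
      refine .trans (by simpa using h2.append (negWord _) []) ?_
      refine ih _ (by simp at hn ⊢; omega) _ _ rfl (absorbNF_one_cons_injective ?_)
      -- Before a `b`, letters can be exchanged freely, so `aⁱ b u' ≡ b bⁱ u'`; cancelling the first
      -- `b` on both sides gives the equality needed.
      have comm : ∀ (i : ℕ) (w : List (Fin 2)),
          List.replicate i 1 ++ 1 :: w = 1 :: (List.replicate i 1 ++ w) := by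
        intro i w
        induction i with
        | zero => rfl
        | succ i ih => rw [List.replicate_succ, List.cons_append, ih]; rfl
      rwa [absorbNF_replicate_append i 0 1 _ (by simp),
        absorbNF_replicate_append j 0 1 _ (by simp), comm, comm] at h
    match u, v with
    | [], [] => exact .refl
    | [], t :: v => simpa [hlen] using congrArg List.length h
    | s :: u, [] => simpa [hlen] using congrArg List.length h
    | s :: u, t :: v =>
      have cancel : absorbNF u = absorbNF v →
          Reverses absorbingRelations (negWord u ++ posWord v) [] :=
        ih u.length (by simp at hn; omega) u v rfl
      fin_cases s <;> fin_cases t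
      · exact (reverses_cancel_append [0] u v).trans
          (cancel (by simpa [absorbNF_zero_cons] using h))
      · obtain ⟨hu, h⟩ := mem h
        have hr : Reverses absorbingRelations (negWord [0] ++ posWord [1])
            (posWord [1] ++ negWord [1]) := reverses_relation (by simp) (by simp) (.inr rfl)
        exact (hr.cons_cons u v).trans (key u v (by simpa using hn) hu h)
      · obtain ⟨hv, h⟩ := mem h.symm
        have hr : Reverses absorbingRelations (negWord [1] ++ posWord [0])
            (posWord [1] ++ negWord [1]) := reverses_relation (by simp) (by simp) (.inl rfl)
        refine (hr.cons_cons u v).trans (key u v (by simpa using hn) ?_ h.symm)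
        rwa [← mem_absorbNF, ← h, mem_absorbNF]
      · exact (reverses_cancel_append [1] u v).trans (cancel (absorbNF_one_cons_injective h))

theorem isRComplete_absorbing : IsRComplete absorbingRelations :=
  fun u v h => reverses_of_absorbNF_eq _ u v rfl (absorbNF_eq h)

/-- Both sides are equivalent to `bⁿ⁺²`. -/
theorem wordEquiv_absorbing (n : ℕ) : WordEquiv absorbingRelations
    (1 :: (List.replicate n 0 ++ [1])) (0 :: (List.replicate n 0 ++ [1])) := by
  have hb : WordEquiv absorbingRelations [1, 1] [0, 1] := .of_mem rfl
  have h : ∀ n, WordEquiv absorbingRelations (List.replicate n 0 ++ [1])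
      (List.replicate (n + 1) 1) := by
    intro n
    induction n with
    | zero => exact .refl _
    | succ n ih => exact (ih.cons 0).trans (hb.symm.append_right (List.replicate n 1))
  exact ((h n).cons 1).trans (h (n + 1)).symm

theorem absorbNF_of_irreducible {w : List (Fin 2)} (hw : IsIrreducibleWord absorbingBasis w) :
    absorbNF w = w := by
  induction w with
  | nil => rfl
  | cons s w ih =>
    have ih := ih fun p hp hi => hw p hp (hi.trans (List.suffix_cons _ _).isInfix)
    fin_cases s
    · exact (absorbNF_zero_cons w).trans (by rw [ih]; rfl)
    · by_cases h : 1 ∈ w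
      · obtain ⟨i, v, rfl⟩ := exists_eq_replicate_append h
        exact (hw _ ⟨i, rfl⟩ ⟨[], v, by simp⟩).elim
      · exact (absorbNF_cons_of_notMem 1 h).trans (by rw [ih]; rfl)

theorem isGCompletion_absorbing : IsGCompletion absorbingRelations absorbingBasis := by
  refine ⟨isGroebnerBasis_of_irreducible ?_ fun w w' hw hw' h => ?_, ?_⟩
  · rintro _ ⟨n, rfl⟩
    exact ⟨wordEquiv_absorbing n, .of_lex rfl (.rel (by decide))⟩
  · rw [← absorbNF_of_irreducible hw, ← absorbNF_of_irreducible hw', absorbNF_eq h]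
  · have count : ∀ {u v : List (Fin 2)}, u <:+: v → u.count 1 ≤ v.count 1 :=
      fun h => h.sublist.count_le 1
    rintro _ ⟨n, rfl⟩ _ ⟨m, rfl⟩ hne
    -- Each leading word has exactly two `b`'s, at its ends, so one is a factor of another only if
    -- they coincide; a right-hand side has a single `b`.
    refine ⟨fun h => hne ?_, fun h => ?_⟩
    · obtain ⟨x, y, hxy⟩ := h
      have hc := congrArg (List.count 1) hxy
      simp [List.count_replicate] at hc
      have hx : x = [] := by
        match x with
        | [] => rfl
        | s :: x =>
          have hs : s = 1 := by simpa using congrArg List.head? hxy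
          simp [hs] at hc
          omega
      have hy : y = [] := by
        rcases y.eq_nil_or_concat with rfl | ⟨y, s, rfl⟩
        · rfl
        · have hs : s = 1 := by
            have := congrArg List.getLast? hxy
            simpa [List.getLast?_append, List.getLast?_cons] using this
          simp [hs] at hc
          omega
      subst hx hy
      have hl := congrArg List.length hxy
      simp at hl
      rw [hl]
    · have := count h
      simp [List.count_replicate] at this

theorem completions_absorbing : CompletionsSatisfy absorbingRelations
    fun G C => C ⊂ G ∧ C.Finite ∧ G.Infinite := by
  have hinf : absorbingBasis.Infinite := by
    refine Set.infinite_range_of_injective fun m n h => ?_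
    simpa using congrArg (fun p => p.1.length) h
  refine .of_isRComplete isGCompletion_absorbing isRComplete_absorbing ⟨?_, ?_, hinf⟩
  · refine ssubset_of_subset_not_subset ?_ fun h => hinf ((Set.finite_singleton _).subset h)
    rintro p rfl
    exact ⟨0, rfl⟩
  · exact Set.finite_singleton _

end Absorbing

/-! ### The monoid `⟨p, q, a, y, z | a q = p a, a z = a y⟩` -/

section Transport

/-- The presentation `a q = p a`, `a z = a y`, with `p = 0`, `q = 1`, `a = 2`, `y = 3`, `z = 4`. -/
def transportRelations : Relations (Fin 5) := {([2, 1], [0, 2]), ([2, 4], [2, 3])}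

/-- The word `qⁿ s`. -/
def transportTail (n : ℕ) (s : Fin 5) : List (Fin 5) := List.replicate n 1 ++ [s]

/-- The relation `a qⁿ z = a qⁿ y`. -/
def transportRelation (n : ℕ) : List (Fin 5) × List (Fin 5) :=
  (2 :: transportTail n 4, 2 :: transportTail n 3)

/-- The reversing completion of `transportRelations` obtained by adding the relations
`a qⁿ z = a qⁿ y` one after the other. -/
def transportCompletion : Relations (Fin 5) :=
  insert ([2, 1], [0, 2]) (Set.range transportRelation)

/-- Left multiplication by `a` on normal forms. -/
def transportPush : List (Fin 5) → List (Fin 5)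
  | [] => [2]
  | s :: n => if s = 1 then 0 :: transportPush n else if s = 4 then 2 :: 3 :: n else 2 :: s :: n

/-- Left multiplication by a letter on normal forms. -/
def transportAct (s : Fin 5) (n : List (Fin 5)) : List (Fin 5) :=
  if s = 2 then transportPush n else s :: n

/-- The normal form of a word. -/
def transportNF (u : List (Fin 5)) : List (Fin 5) := u.foldr transportAct []

theorem transportNF_cons_a (u : List (Fin 5)) :
    transportNF (2 :: u) = transportPush (transportNF u) := rfl

theorem transportNF_cons {s : Fin 5} (hs : s ≠ 2) (u : List (Fin 5)) :
    transportNF (s :: u) = s :: transportNF u := by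
  rw [transportNF, List.foldr_cons, transportAct, if_neg hs, transportNF]

theorem transportPush_head {n m : List (Fin 5)} {s : Fin 5} (h : transportPush n = s :: m) :
    s = 0 ∧ (∃ n', n = 1 :: n' ∧ transportPush n' = m) ∨ s = 2 := by
  match n with
  | [] => simp [transportPush] at h; simp [h]
  | t :: n =>
    rw [transportPush] at h
    split_ifs at h with h1 h2
    · rw [List.cons.injEq] at h
      exact .inl ⟨h.1.symm, n, by rw [h1], h.2⟩
    · rw [List.cons.injEq] at h
      exact .inr h.1.symm
    · rw [List.cons.injEq] at h
      exact .inr h.1.symm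

theorem length_transportPush (n : List (Fin 5)) : (transportPush n).length = n.length + 1 := by
  induction n with
  | nil => rfl
  | cons s n ih => rw [transportPush]; split_ifs <;> simp [ih]

theorem length_transportNF (u : List (Fin 5)) : (transportNF u).length = u.length := by
  induction u with
  | nil => rfl
  | cons s u ih =>
    by_cases hs : s = 2
    · rw [hs, transportNF_cons_a, length_transportPush, ih, List.length_cons]
    · rw [transportNF_cons hs, List.length_cons, List.length_cons, ih]

theorem transportNF_eq {u v : List (Fin 5)} (h : WordEquiv transportRelations u v) :
    transportNF u = transportNF v := by
  refine h.foldr_eq ?_ []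
  rintro p (rfl | rfl) x <;> simp [transportAct, transportPush]

theorem wordEquiv_transportPush (n : List (Fin 5)) :
    WordEquiv transportRelations (2 :: n) (transportPush n) := by
  induction n with
  | nil => exact .refl _
  | cons s n ih =>
    rw [transportPush]
    split_ifs with h1 h2
    · subst h1
      have : WordEquiv transportRelations [2, 1] [0, 2] := .of_mem (by simp [transportRelations])
      exact (this.append_right n).trans (ih.cons 0)
    · subst h2
      have : WordEquiv transportRelations [2, 4] [2, 3] := .of_mem (by simp [transportRelations])
      exact this.append_right n
    · exact .refl _

theorem wordEquiv_transportNF (u : List (Fin 5)) :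
    WordEquiv transportRelations u (transportNF u) := by
  induction u with
  | nil => exact .refl _
  | cons s u ih =>
    by_cases hs : s = 2
    · subst hs
      exact (ih.cons 2).trans (wordEquiv_transportPush _)
    · rw [transportNF_cons hs]
      exact ih.cons s

theorem wordEquiv_of_transportNF_eq {u v : List (Fin 5)} (h : transportNF u = transportNF v) :
    WordEquiv transportRelations u v :=
  (wordEquiv_transportNF u).trans (h ▸ (wordEquiv_transportNF v).symm)

/-- Left cancellation of `a` fails only for the words `qⁿ z x` and `qⁿ y x`. -/
theorem transportPush_eq {m m' : List (Fin 5)} (h : transportPush m = transportPush m') :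
    m = m' ∨ ∃ n x, (m = transportTail n 4 ++ x ∧ m' = transportTail n 3 ++ x) ∨
      (m = transportTail n 3 ++ x ∧ m' = transportTail n 4 ++ x) := by
  induction m generalizing m' with
  | nil =>
    match m' with
    | [] => exact .inl rfl
    | s :: m' => simpa [length_transportPush] using congrArg List.length h
  | cons s m ih =>
    match m' with
    | [] => simpa [length_transportPush] using congrArg List.length h
    | t :: m' =>
      by_cases hst : s = 1 ∧ t = 1
      · obtain ⟨rfl, rfl⟩ := hst
        rcases ih (m' := m') (by simpa [transportPush] using h) with h | ⟨n, x, h⟩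
        · exact .inl (by rw [h])
        · refine .inr ⟨n + 1, x, ?_⟩
          simpa [transportTail, List.replicate_succ] using h
      · by_cases hst' : s = t
        · subst hst'
          left
          rw [transportPush, transportPush] at h
          split_ifs at h <;> simp_all
        · right
          refine ⟨0, m, ?_⟩
          rw [transportPush, transportPush] at h
          split_ifs at h <;> simp_all [transportTail, eq_comm]

/-- A word starting with `a` has a normal form starting with `p` or `a`; any other first letter is
left untouched. -/
theorem eq_cons_of_transportNF {u m : List (Fin 5)} {s : Fin 5} (h0 : s ≠ 0) (h2 : s ≠ 2)
    (h : transportNF u = s :: m) : ∃ u', u = s :: u' ∧ transportNF u' = m := by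
  match u with
  | [] => simp [transportNF] at h
  | t :: u =>
    by_cases ht : t = 2
    · subst ht
      rcases transportPush_head h with h | h
      · exact (h0 h.1).elim
      · exact (h2 h).elim
    · rw [transportNF_cons ht, List.cons.injEq] at h
      exact ⟨u, by rw [h.1], h.2⟩

theorem eq_append_of_transportNF {n : ℕ} {u m : List (Fin 5)} {s : Fin 5} (h0 : s ≠ 0)
    (h2 : s ≠ 2) (h : transportNF u = transportTail n s ++ m) :
    ∃ u', u = transportTail n s ++ u' ∧ transportNF u' = m := by
  induction n generalizing u with
  | zero => exact eq_cons_of_transportNF h0 h2 h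
  | succ n ih =>
    obtain ⟨u', rfl, h'⟩ := eq_cons_of_transportNF (by decide) (by decide) h
    obtain ⟨u'', rfl, h''⟩ := ih h'
    exact ⟨u'', rfl, h''⟩

theorem transportNF_tail_ne (n : ℕ) :
    transportNF (transportTail n 4) ≠ transportNF (transportTail n 3) := by
  induction n with
  | zero => decide
  | succ n ih =>
    have h : ∀ s, transportNF (transportTail (n + 1) s) = 1 :: transportNF (transportTail n s) :=
      fun s => transportNF_cons (by decide) (transportTail n s)
    rw [h, h]
    simpa using ih

/-- Equality of words starting with `a`, in terms of the words that follow. -/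
theorem transportNF_cons_a_eq {u v : List (Fin 5)}
    (h : transportNF (2 :: u) = transportNF (2 :: v)) :
    transportNF u = transportNF v ∨ ∃ n u' v', transportNF u' = transportNF v' ∧
      ((u = transportTail n 4 ++ u' ∧ v = transportTail n 3 ++ v') ∨
        (u = transportTail n 3 ++ u' ∧ v = transportTail n 4 ++ v')) := by
  rcases transportPush_eq h with h | ⟨n, x, ⟨hu, hv⟩ | ⟨hu, hv⟩⟩
  · exact .inl h
  · obtain ⟨u', rfl, hu'⟩ := eq_append_of_transportNF (by decide) (by decide) hu
    obtain ⟨v', rfl, hv'⟩ := eq_append_of_transportNF (by decide) (by decide) hv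
    exact .inr ⟨n, u', v', hu'.trans hv'.symm, .inl ⟨rfl, rfl⟩⟩
  · obtain ⟨u', rfl, hu'⟩ := eq_append_of_transportNF (by decide) (by decide) hu
    obtain ⟨v', rfl, hv'⟩ := eq_append_of_transportNF (by decide) (by decide) hv
    exact .inr ⟨n, u', v', hu'.trans hv'.symm, .inr ⟨rfl, rfl⟩⟩

/-! #### Completeness -/

theorem reverses_push {C : Relations (Fin 5)} (hC : ([2, 1], [0, 2]) ∈ C) :
    Reverses C (negWord [2] ++ posWord [0]) (posWord [1] ++ negWord [2]) :=
  reverses_relation (u := [2]) (v := [0]) (by simp) (by simp) (.inl hC)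

theorem reverses_push' {C : Relations (Fin 5)} (hC : ([2, 1], [0, 2]) ∈ C) :
    Reverses C (negWord [0] ++ posWord [2]) (posWord [2] ++ negWord [1]) :=
  reverses_relation (u := [0]) (v := [2]) (by simp) (by simp) (.inr hC)

/-- Induction on length. If both words start with `a`, either `a` cancels or some `a qᵐ z = a qᵐ y`
applies. If one starts with `a` and the other with `p`, the `a` is followed by `q` and `a q = p a`
applies. Otherwise the first letters agree. -/
theorem reverses_of_transportNF_eq {C : Relations (Fin 5)} (hC : transportCompletion ⊆ C) :
    ∀ n, ∀ u v : List (Fin 5), u.length = n → transportNF u = transportNF v →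
      Reverses C (negWord u ++ posWord v) [] := by
  have hpush : ([2, 1], [0, 2]) ∈ C := hC (.inl rfl)
  have hrel : ∀ n, transportRelation n ∈ C := fun n => hC (.inr ⟨n, rfl⟩)
  intro n
  induction n using Nat.strong_induction_on with
  | _ n ih =>
    intro u v hn h
    match u, v with
    | [], [] => exact .refl
    | [], t :: v => simpa [length_transportNF] using congrArg List.length h
    | s :: u, [] => simpa [length_transportNF] using congrArg List.length h
    | s :: u, t :: v =>
      have hlt : u.length < n := by simp at hn; omega
      by_cases hs : s = 2 <;> by_cases ht : t = 2
      · subst hs ht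
        rcases transportNF_cons_a_eq h with h | ⟨m, u', v', huv, hcase⟩
        · exact (reverses_cancel_append [2] u v).trans (ih _ hlt u v rfl h)
        · have key : ∀ x y : List (Fin 5), ((2 :: x, 2 :: y) ∈ C ∨ (2 :: y, 2 :: x) ∈ C) →
              u = x ++ u' → v = y ++ v' →
              Reverses C (negWord (2 :: u) ++ posWord (2 :: v)) [] := by
            rintro x y hxy rfl rfl
            have hr : Reverses C (negWord [2] ++ posWord [2]) (posWord x ++ negWord y) :=
              reverses_relation (by simp) (by simp) hxy
            refine (hr.cons_cons _ _).trans ?_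
            refine .trans (w' := negWord u' ++ (negWord y ++ posWord y) ++ posWord v') ?_ ?_
            · simpa [negWord_append, posWord_append] using
                (reverses_cancel x).append (negWord u') (negWord y ++ posWord (y ++ v'))
            · refine ((reverses_cancel y).append (negWord u') (posWord v')).trans ?_
              have : u'.length < n := by simp at hlt; omega
              simpa using ih _ this u' v' rfl huv
          rcases hcase with ⟨hu, hv⟩ | ⟨hu, hv⟩
          · exact key _ _ (.inl (hrel m)) hu hv
          · exact key _ _ (.inr (hrel m)) hu hv
      · subst hs
        rw [transportNF_cons_a, transportNF_cons ht] at h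
        rcases transportPush_head h with ⟨rfl, m, hm, h'⟩ | h'
        · obtain ⟨u', rfl, rfl⟩ := eq_cons_of_transportNF (by decide) (by decide) hm
          refine ((reverses_push hpush).cons_cons _ _).trans ?_
          refine .trans (w' := negWord (2 :: u') ++ posWord v) ?_ ?_
          · simpa [negWord_cons 1 u', negWord_cons 2 u'] using
              (reverses_cancel [1]).append (negWord u') (negWord [2] ++ posWord v)
          · exact ih _ (by simpa using hlt) (2 :: u') v rfl h'
        · exact (ht h').elim
      · subst ht
        rw [transportNF_cons_a, transportNF_cons hs] at h
        rcases transportPush_head h.symm with ⟨rfl, m, hm, h'⟩ | h'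
        · obtain ⟨v', rfl, rfl⟩ := eq_cons_of_transportNF (by decide) (by decide) hm
          refine ((reverses_push' hpush).cons_cons _ _).trans ?_
          refine .trans (w' := negWord u ++ posWord (2 :: v')) ?_ ?_
          · simpa [posWord_cons 1 v', posWord_cons 2 v'] using
              ((reverses_cancel [1]).append (posWord [2]) (posWord v')).append (negWord u) []
          · exact ih _ hlt u (2 :: v') rfl h'.symm
        · exact (hs h').elim
      · rw [transportNF_cons hs, transportNF_cons ht, List.cons.injEq] at h
        obtain ⟨rfl, h⟩ := h
        exact (reverses_cancel_append [s] u v).trans (ih _ hlt u v rfl h)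

theorem wordEquiv_transportTail (n : ℕ) : WordEquiv transportRelations
    (2 :: transportTail n 4) (2 :: transportTail n 3) := by
  refine wordEquiv_of_transportNF_eq ?_
  rw [transportNF_cons_a, transportNF_cons_a]
  induction n with
  | zero => decide
  | succ n ih =>
    have h : ∀ s, transportNF (transportTail (n + 1) s) = 1 :: transportNF (transportTail n s) :=
      fun s => transportNF_cons (by decide) (transportTail n s)
    rw [h, h, transportPush, transportPush, if_pos rfl, if_pos rfl, ih]

theorem transportCompletion_wordEquiv :
    ∀ p ∈ transportCompletion, WordEquiv transportRelations p.1 p.2 := by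
  rintro p (rfl | ⟨n, rfl⟩)
  · exact .of_mem (by simp [transportRelations])
  · exact wordEquiv_transportTail n

theorem isRComplete_transportCompletion : IsRComplete transportCompletion := fun u v h =>
  reverses_of_transportNF_eq subset_rfl _ u v rfl
    (transportNF_eq (h.mono transportCompletion_wordEquiv))

/-! #### The relations `a qⁿ z = a qⁿ y` are unavoidable -/

/-- An automaton that reads the prefixes of `qⁿ z` and of `qⁿ y`, the letters `a` and `p` leading
to the sink `none`. -/
def transportRead (n : ℕ) (x : Option (Bool × List (Fin 5))) (s : Fin 5) :
    Option (Bool × List (Fin 5)) :=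
  x.bind fun bw =>
    if bw.2 ++ [s] <+: transportTail n (if bw.1 then 4 else 3) then some (bw.1, bw.2 ++ [s])
    else none

theorem foldl_transportRead_none (n : ℕ) (u : List (Fin 5)) :
    u.foldl (transportRead n) none = none := by
  induction u with
  | nil => rfl
  | cons s u ih => exact ih

theorem foldl_transportRead (n : ℕ) (b : Bool) (w u : List (Fin 5))
    (hw : w <+: transportTail n (if b then 4 else 3)) :
    u.foldl (transportRead n) (some (b, w)) =
      if w ++ u <+: transportTail n (if b then 4 else 3) then some (b, w ++ u) else none := by
  induction u generalizing w with
  | nil => simp [hw]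
  | cons s u ih =>
    rw [List.foldl_cons]
    by_cases h : w ++ [s] <+: transportTail n (if b then 4 else 3)
    · have : transportRead n (some (b, w)) s = some (b, w ++ [s]) := if_pos h
      rw [this, ih _ h]
      simp
    · have : transportRead n (some (b, w)) s = none := if_neg h
      rw [this, foldl_transportRead_none, if_neg]
      exact fun h' => h (.trans ⟨u, by simp⟩ h')

theorem transportRead_sink (n : ℕ) (x : Option (Bool × List (Fin 5))) {s : Fin 5}
    (hs : s = 0 ∨ s = 2) : transportRead n x s = none := by
  match x with
  | none => rfl
  | some (b, w) =>
    refine if_neg fun h => ?_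
    have : s ∈ transportTail n (if b then 4 else 3) := h.subset (by simp)
    rcases hs with rfl | rfl <;> cases b <;> simp [transportTail, List.mem_replicate] at this

/-- Both sides of each defining relation contain `a`, so both send every state to the sink. -/
theorem transportRead_compatible {C : Relations (Fin 5)}
    (hC : ∀ p ∈ C, WordEquiv transportRelations p.1 p.2) (n : ℕ) :
    ∀ p ∈ C, ∀ x, p.1.foldl (transportRead n) x = p.2.foldl (transportRead n) x := by
  refine fun p hp => (hC p hp).foldl_eq ?_
  rintro p (rfl | rfl) x <;> simp [transportRead_sink] <;> rfl

theorem transportTail_append_prefix {m n : ℕ} {s t : Fin 5} {x : List (Fin 5)} (hs : s ≠ 1)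
    (h : transportTail m s ++ x <+: transportTail n t) : m = n ∧ s = t ∧ x = [] := by
  induction m generalizing n with
  | zero =>
    match n with
    | 0 => simpa [transportTail] using h
    | n + 1 => simp [transportTail, List.replicate_succ, hs] at h
  | succ m ih =>
    match n with
    | 0 => simp [transportTail, List.replicate_succ] at h
    | n + 1 =>
      have := ih (n := n) (by simpa [transportTail, List.replicate_succ] using h)
      simpa using this

/-- If `a qⁿ z` and `a qⁿ y` are proved equivalent by reversing, the relation `a qⁿ z = a qⁿ y`
has been used. -/
theorem mem_of_reverses_transport {C : Relations (Fin 5)}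
    (hC : ∀ p ∈ C, WordEquiv transportRelations p.1 p.2) {n : ℕ}
    (h : Reverses C (negWord (2 :: transportTail n 4) ++ posWord (2 :: transportTail n 3)) []) :
    transportRelation n ∈ C ∨ (transportRelation n).swap ∈ C := by
  obtain ⟨u, v, u', v', U, V, hu, hv, hp, hq, hr, h⟩ := h.exists_first_step (by simp)
  match u, v with
  | [], _ => exact (hu rfl).elim
  | _, [] => exact (hv rfl).elim
  | s :: u, t :: v =>
    simp only [List.cons_append, List.cons.injEq] at hp hq
    obtain ⟨rfl, hp⟩ := hp
    obtain ⟨rfl, hq⟩ := hq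
    have hequiv : transportNF (2 :: (u ++ v')) = transportNF (2 :: (v ++ u')) := by
      rcases hr with ⟨h1, rfl, rfl⟩ | hr | hr
      · rw [List.cons.injEq] at h1
        rw [h1.2]
      · exact transportNF_eq (hC _ hr)
      · exact (transportNF_eq (hC _ hr)).symm
    -- If `u v' ≡ v u'`, the first step amounts to cancelling `a`, and the remaining reversing would
    -- prove the false equivalence `qⁿ z ≡ qⁿ y`.
    rcases transportNF_cons_a_eq hequiv with heq | ⟨m, x, y, hxy, hcase⟩
    · have path : SignedPath (mulLetter transportRelations)
          (negWord U ++ posWord v' ++ negWord u' ++ posWord V)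
          (wordClass _ (transportTail n 4)) (wordClass _ (transportTail n 3)) := by
        simp only [signedPath_append, signedPath_posWord, signedPath_negWord]
        refine ⟨wordClass _ v, ⟨wordClass _ (v ++ u'), ⟨wordClass _ u, ?_, ?_⟩, ?_⟩, ?_⟩
        · rw [foldl_mulLetter, hp]
        · rw [foldl_mulLetter, wordClass_eq_iff]
          exact wordEquiv_of_transportNF_eq heq
        · rw [foldl_mulLetter]
        · rw [foldl_mulLetter, hq]
      have := h.eq_of_signedPath (mulLetter_compatible hC) path
      exact (transportNF_tail_ne n (transportNF_eq (wordClass_eq_iff.1 this))).elim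
    -- Otherwise the automaton decides: if both `u v'` and `v u'` fell into the sink, the word after
    -- the first step would label a path between the ends of the two branches, yet it reverses to
    -- the empty word.
    · have hread : v'.foldl (transportRead n) (some (true, u)) ≠
          u'.foldl (transportRead n) (some (false, v)) := by
        intro hne
        have path : SignedPath (transportRead n)
            (negWord U ++ posWord v' ++ negWord u' ++ posWord V)
            (some (true, transportTail n 4)) (some (false, transportTail n 3)) := by
          simp only [signedPath_append, signedPath_posWord, signedPath_negWord]
          refine ⟨some (false, v), ⟨_, ⟨some (true, u), ?_, hne⟩, rfl⟩, ?_⟩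
          · rw [foldl_transportRead _ _ _ _ ⟨U, hp.symm⟩, ← hp]
            simp
          · rw [foldl_transportRead _ _ _ _ ⟨V, hq.symm⟩, ← hq]
            simp
        simpa using h.eq_of_signedPath (transportRead_compatible hC n) path
      have hlen : x.length = y.length := by
        simpa [length_transportNF] using congrArg List.length hxy
      rw [foldl_transportRead _ _ _ _ ⟨U, hp.symm⟩, foldl_transportRead _ _ _ _ ⟨V, hq.symm⟩]
        at hread
      rcases hcase with ⟨h1, h2⟩ | ⟨h1, h2⟩
      -- One of the two words stays on its branch, which fixes `m` and empties its remainder; the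
      -- other remainder has the same length.
      · have hmn : m = n ∧ x = [] ∧ y = [] := by
          by_cases hx : u ++ v' <+: transportTail n 4
          · rw [h1] at hx
            obtain ⟨hm, -, rfl⟩ := transportTail_append_prefix (by decide) hx
            exact ⟨hm, rfl, List.length_eq_zero_iff.1 hlen.symm⟩
          · by_cases hy : v ++ u' <+: transportTail n 3
            · rw [h2] at hy
              obtain ⟨hm, -, rfl⟩ := transportTail_append_prefix (by decide) hy
              exact ⟨hm, List.length_eq_zero_iff.1 hlen, rfl⟩
            · simp [hx, hy] at hread
        obtain ⟨rfl, rfl, rfl⟩ := hmn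
        simp only [List.append_nil] at h1 h2
        simp only [List.cons_append, h1, h2] at hr
        rcases hr with ⟨ht, rfl, rfl⟩ | hr
        · rw [List.cons.injEq] at ht
          simp [ht.2, transportTail] at h1 h2
          simp [h1] at h2
        · exact hr
      -- With `z` and `y` exchanged, both words leave their branches and meet in the sink.
      · have hx : ¬ u ++ v' <+: transportTail n 4 := by
          rw [h1]
          exact fun hx => absurd (transportTail_append_prefix (by decide) hx).2.1 (by decide)
        have hy : ¬ v ++ u' <+: transportTail n 3 := by
          rw [h2]
          exact fun hy => absurd (transportTail_append_prefix (by decide) hy).2.1 (by decide)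
        simp [hx, hy] at hread

/-! #### The completions -/

/-- The obstruction that produces `a qⁿ⁺¹ z = a qⁿ⁺¹ y` from `a qⁿ z = a qⁿ y`. -/
theorem reverses_transport_succ {C : Relations (Fin 5)} (hC : ([2, 1], [0, 2]) ∈ C) {n : ℕ}
    (hn : transportRelation n ∈ C ∨ (transportRelation n).swap ∈ C) :
    Reverses C (negWord [2] ++ posWord [0] ++ negWord [0] ++ posWord [2])
      (posWord (transportTail (n + 1) 4) ++ negWord (transportTail (n + 1) 3)) := by
  have hr : Reverses C (negWord [2] ++ posWord [2])
      (posWord (transportTail n 4) ++ negWord (transportTail n 3)) :=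
    reverses_relation (by simp) (by simp) hn
  -- The word `a⁻¹ p p⁻¹ a` becomes `q a⁻¹ a q⁻¹`, and the `n`-th relation is applied to the inner
  -- `a⁻¹ a` in place of cancellation.
  have h1 := (reverses_push hC).append [] (negWord [0] ++ posWord [2])
  have h2 := (reverses_push' hC).append (posWord [1] ++ negWord [2]) []
  have h3 := hr.append (posWord [1]) (negWord [1])
  have e : ∀ s, transportTail (n + 1) s = 1 :: transportTail n s := fun s => rfl
  rw [e, e, negWord_cons 1, posWord_cons 1]
  refine .trans (by simpa using h1) (.trans (by simpa using h2) ?_)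
  simpa using h3

theorem isRCompletion_transportCompletion :
    IsRCompletion transportRelations transportCompletion := by
  refine ⟨⟨fun n => insert ([2, 1], [0, 2]) (transportRelation '' {i | i ≤ n}), ?_, ?_, ?_⟩,
    isRComplete_transportCompletion.not_isObstruction⟩
  · have : {i : ℕ | i ≤ 0} = {0} := by ext; simp
    simp only [this, Set.image_singleton]
    rfl
  · intro n
    have hinj : ∀ m k, transportRelation m = transportRelation k → m = k := fun m k h => by
      simpa [transportRelation, transportTail] using congrArg (fun p => p.1.length) h
    refine .inr ⟨2, 2, transportTail (n + 1) 4, transportTail (n + 1) 3, ⟨⟨0, ?_⟩, fun h => ?_⟩, ?_⟩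
    · exact reverses_transport_succ (.inl rfl) (.inl (.inr ⟨n, le_refl n, rfl⟩))
    · have hval : ∀ p ∈ (insert ([2, 1], [0, 2]) (transportRelation '' {i | i ≤ n}) :
          Relations (Fin 5)), WordEquiv transportRelations p.1 p.2 := fun p hp =>
        transportCompletion_wordEquiv p (hp.imp id fun ⟨i, _, hi⟩ => ⟨i, hi⟩)
      -- The obstruction is genuine because relation `n + 1` is not yet present, in either
      -- orientation.
      rcases mem_of_reverses_transport hval h with (h | ⟨i, hi, h⟩) | (h | ⟨i, hi, h⟩)
      · simp [transportRelation, transportTail, List.replicate_succ] at h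
      · have := hinj _ _ h
        simp at hi; omega
      · simp [transportRelation, transportTail, List.replicate_succ] at h
      · have := congrArg (fun p => p.1.getLast?) h
        simp [transportRelation, transportTail, List.getLast?_cons] at this
    · have : {i : ℕ | i ≤ n + 1} = insert (n + 1) {i | i ≤ n} := by ext; simp; omega
      simp only [this, Set.image_insert_eq]
      exact Set.insert_comm _ _ _
  · rw [transportCompletion, ← Set.insert_iUnion, ← Set.image_iUnion, ← Set.image_univ]
    congr 2
    ext i
    simpa using ⟨i, le_refl i⟩

/-- The `n`-th relation gives the first half of an obstruction; as none is left in `C`, the next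
pair must reverse to the empty word, which requires its relation. The run may have added it in
either orientation. -/
theorem transportRelation_mem {C : Relations (Fin 5)} (hC : IsRCompletion transportRelations C)
    (n : ℕ) : transportRelation n ∈ C ∨ (transportRelation n).swap ∈ C := by
  have hsub := hC.subset
  induction n with
  | zero => exact .inl (hsub (.inr rfl))
  | succ n ih =>
    by_contra hn
    exact hC.2 2 2 _ _ ⟨⟨0, reverses_transport_succ (hsub (.inl rfl)) ih⟩,
      fun h => hn (mem_of_reverses_transport hC.wordEquiv h)⟩

theorem infinite_of_isRCompletion_transport {C : Relations (Fin 5)}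
    (hC : IsRCompletion transportRelations C) : C.Infinite := by
  have h : ∀ n, ∃ p ∈ C, p.1.length = n + 2 := by
    intro n
    rcases transportRelation_mem hC n with h | h
    · exact ⟨_, h, by simp [transportRelation, transportTail]⟩
    · exact ⟨_, h, by simp [transportRelation, transportTail]⟩
  choose f hf hl using h
  refine Set.infinite_of_injective_forall_mem (f := f) (fun m n hmn => ?_) hf
  have := hl m
  rw [hmn, hl n] at this
  omega

theorem transportNF_of_irreducible {w : List (Fin 5)}
    (hw : IsIrreducibleWord transportRelations w) : transportNF w = w := by
  induction w with
  | nil => rfl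
  | cons s w ih =>
    have ih := ih fun p hp hi => hw p hp (hi.trans (List.suffix_cons _ _).isInfix)
    by_cases hs : s = 2
    · subst hs
      rw [transportNF_cons_a, ih]
      match w with
      | [] => rfl
      | t :: w =>
        rw [transportPush, if_neg, if_neg]
        · rintro rfl
          exact hw ([2, 4], [2, 3]) (.inr rfl) ⟨[], w, rfl⟩
        · rintro rfl
          exact hw ([2, 1], [0, 2]) (.inl rfl) ⟨[], w, rfl⟩
    · rw [transportNF_cons hs, ih]

/-- The leading words `a q` and `a z` do not overlap, so nothing has to be added. -/
theorem isGCompletion_transport : IsGCompletion transportRelations transportRelations := by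
  refine ⟨isGroebnerBasis_of_irreducible ?_ fun w w' hw hw' h => ?_, ?_⟩
  · intro p hp
    refine ⟨.of_mem hp, ?_⟩
    rcases hp with rfl | rfl
    · exact .of_lex rfl (.rel (by decide))
    · exact .of_lex rfl (.cons (.rel (by decide)))
  · rw [← transportNF_of_irreducible hw, ← transportNF_of_irreducible hw', transportNF_eq h]
  · unfold IsReducedRelations transportRelations
    simp only [Set.mem_insert_iff, Set.mem_singleton_iff, forall_eq_or_imp, forall_eq]
    decide

theorem completions_transport : CompletionsSatisfy transportRelations
    fun G C => G ⊂ C ∧ G.Finite ∧ C.Infinite := by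
  have hfin : transportRelations.Finite := (Set.finite_singleton _).insert _
  refine ⟨⟨_, isGCompletion_transport⟩, ⟨_, isRCompletion_transportCompletion,
    isRComplete_transportCompletion⟩, fun G C hG hC => ?_⟩
  rw [hG.unique isGCompletion_transport]
  have hinf := infinite_of_isRCompletion_transport hC
  exact ⟨ssubset_of_subset_not_subset hC.subset fun h => hinf (hfin.subset h), hfin, hinf⟩

end Transport

/-! ### The four behaviours -/

theorem mainTheorem1 :
    -- type 1
    (∃ (k : ℕ) (R : Relations (Fin k)), IsFinitePresentation R ∧
      CompletionsSatisfy R fun G C => C ⊂ G ∧ C.Finite ∧ G.Infinite) ∧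
    -- type 1'
    (∃ (k : ℕ) (R : Relations (Fin k)), IsFinitePresentation R ∧
      CompletionsSatisfy R fun G C => C ⊂ G ∧ C.Finite ∧ G.Finite) ∧
    -- type 2
    (∃ (k : ℕ) (R : Relations (Fin k)), IsFinitePresentation R ∧
      CompletionsSatisfy R fun G C => G ⊂ C ∧ G.Finite ∧ C.Infinite) ∧
    -- type 3
    (∃ (k : ℕ) (R : Relations (Fin k)), IsFinitePresentation R ∧
      CompletionsSatisfy R fun G C =>
        ¬ equations G ⊆ equations C ∧ ¬ equations C ⊆ equations G) := by
  refine ⟨⟨2, absorbingRelations, ⟨Set.finite_singleton _, ?_⟩, completions_absorbing⟩,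
    ⟨2, squareRelations, ⟨Set.finite_singleton _, ?_⟩, completions_square⟩,
    ⟨5, transportRelations, ⟨(Set.finite_singleton _).insert _, ?_⟩, completions_transport⟩,
    ⟨4, doubleSquareRelations, ⟨(Set.finite_singleton _).insert _, ?_⟩, completions_doubleSquare⟩⟩
  · rintro p rfl; simp
  · rintro p rfl; simp
  · rintro p (rfl | rfl) <;> simp
  · rintro p (rfl | rfl) <;> simp
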